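/- **Setting.** Let $\mathbf C_{[0,1]}$ be the set of $\phi\in\mathcal C^2([0,1])$ with $\phi'>0$ on $[0,1]$, either $\phi''>0$ on $[0,1]$ or $\phi''<0$ on $[0,1]$, $\phi(0)=0$ and $\phi(1)=1$. Let $\mathcal N_0$ be the indicator function of $[0,1)$ and, for $p\ge1$, $$\mathcal N_p(x)=\frac{x}{p}\,\mathcal N_{p-1}(x)+\frac{p+1-x}{p}\,\mathcal N_{p-1}(x-1),\qquad x\in\mathbb R$$ (the cardinal B-splines). For an integer $p\ge 1$ and $\theta\in[0,\pi]$ put $$f_p(\theta)=-\mathcal N_{2p+1}''(p+1)-2\sum_{k=1}^p\mathcal N_{2p+1}''(p+1-k)\cos(k\theta),$$ $$g_p(\theta)=\mathcal N_{2p+1}(p+1)+2\sum_{k=1}^p\mathcal N_{2p+1}(p+1-k)\cos(k\theta),\qquad e_p=\frac{f_p}{g_p},$$ and, for $\phi\in\mathbf C_{[0,1]}$, $\omega_\phi^p(x,\theta)=e_p(\theta)/\phi'(x)^2$ on $[0,1]\times[0,\pi]$. With $\mu_2$ the Lebesgue measure on $\mathbb R^2$, let $$\Psi_\phi^p(y)=\mu_2\bigl(\{(x,\theta)\in[0,1]\times[0,\pi]:\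 \sqrt{\omega_\phi^p(x,\theta)}\le y\}\bigr),\qquad y\in\mathbb R,$$ let $R$ be the essential range of $\sqrt{\omega_\phi^p}$, i.e. the set of $y\in\mathbb R$ such that $\mu_2(\{(x,\theta)\in[0,1]\times[0,\pi]: |\sqrt{\omega_\phi^p(x,\theta)}-y|<\epsilon\})>0$ for every $\epsilon>0$, and let the eigenfrequency symbol be the monotone rearrangement $$\sqrt{\xi_\phi^p}(x)=\inf\{y\in R:\ \Psi_\phi^p(y)>\pi x\},\qquad x\in(0,1).$$ Write $(\Psi_\phi^p)'(0)$ for the right derivative of $\Psi_\phi^p$ at $0$. **Theorem.** Let $p\ge1$ be an integer and let $\phi\in\mathbf C_{[0,1]}$ be convex. Then $\Psi_\phi^p$ maps $R$ bijectively onto $[0,\pi]$, and $\sqrt{\xi_\phi^p}(x)=(\Psi_\phi^p|_R)^{-1}(\pi x)$ for all $x\in(0,1)$. The right derivative $(\Psi_\phi^p)'(0)$ exists and is positive, and $$\sqrt{\xi_\phi^p}(x)\sim\gamma x\quad\text{as }x\to0^+,\qquad \gamma:=\frac{\pi}{(\Psi_\phi^p)'(0)}>0.$$ Moreover, if $p\ge2$,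 then $$\Bigl(\frac2\pi\Bigr)^{(p+1)/2}\le(\Psi_\phi^p)'(0)\le\Bigl(\frac\pi2\Bigr)^{(p-1)/2}.$$ -/

import Mathlib

noncomputable section

namespace IGASymbol

/-- The admissible reparametrizations of `[0,1]`: `φ ∈ C²([0,1])` with `φ' > 0` on `[0,1]`,
`φ'' > 0` on `[0,1]` or `φ'' < 0` on `[0,1]`, `φ 0 = 0` and `φ 1 = 1`.
Derivatives are taken within `[0,1]`, so they are one-sided at the end points, and the values of
`φ` outside `[0,1]` play no role. -/
structure IsReparam (φ : ℝ → ℝ) : Prop where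
  contDiffOn : ContDiffOn ℝ 2 φ (Set.Icc 0 1)
  deriv_pos : ∀ x ∈ Set.Icc (0 : ℝ) 1, 0 < derivWithin φ (Set.Icc 0 1) x
  second_deriv_sign :
    (∀ x ∈ Set.Icc (0 : ℝ) 1, 0 < iteratedDerivWithin 2 φ (Set.Icc 0 1) x) ∨
    (∀ x ∈ Set.Icc (0 : ℝ) 1, iteratedDerivWithin 2 φ (Set.Icc 0 1) x < 0)
  map_zero : φ 0 = 0
  map_one : φ 1 = 1

/-- The cardinal B-spline `𝒩_p` of degree `p`. The half-open interval `[0,1)` in degree `0` makes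
`𝒩_p` the usual function of class `C^(p-1)` at the integers too. -/
def cardBSpline : ℕ → ℝ → ℝ
  | 0, x => Set.indicator (Set.Ico (0 : ℝ) 1) (fun _ => (1 : ℝ)) x
  | p + 1, x =>
      x / ((p : ℝ) + 1) * cardBSpline p x
        + (((p : ℝ) + 1) + 1 - x) / ((p : ℝ) + 1) * cardBSpline p (x - 1)

/-- `f_p(θ) = -𝒩''_{2p+1}(p+1) - 2 ∑_{k=1}^p 𝒩''_{2p+1}(p+1-k) cos(kθ)`. -/
def fSymb (p : ℕ) (θ : ℝ) : ℝ :=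
  -(iteratedDeriv 2 (cardBSpline (2 * p + 1)) ((p : ℝ) + 1))
    - 2 * ∑ k ∈ Finset.Icc 1 p,
        iteratedDeriv 2 (cardBSpline (2 * p + 1)) ((p : ℝ) + 1 - (k : ℝ)) * Real.cos ((k : ℝ) * θ)

/-- `g_p(θ) = 𝒩_{2p+1}(p+1) + 2 ∑_{k=1}^p 𝒩_{2p+1}(p+1-k) cos(kθ)`. -/
def gSymb (p : ℕ) (θ : ℝ) : ℝ :=
  cardBSpline (2 * p + 1) ((p : ℝ) + 1)
    + 2 * ∑ k ∈ Finset.Icc 1 p,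
        cardBSpline (2 * p + 1) ((p : ℝ) + 1 - (k : ℝ)) * Real.cos ((k : ℝ) * θ)

/-- `e_p = f_p / g_p`. -/
def eSymb (p : ℕ) (θ : ℝ) : ℝ := fSymb p θ / gSymb p θ

/-- `√ω`, where `ω(x,θ) = e_p(θ) / φ'(x)²` on `[0,1] × [0,π]`. -/
def sqrtOmega (p : ℕ) (φ : ℝ → ℝ) (z : ℝ × ℝ) : ℝ :=
  Real.sqrt (eSymb p z.2 / (derivWithin φ (Set.Icc 0 1) z.1) ^ 2)

/-- The rectangle `[0,1] × [0,π]`. -/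
def rect : Set (ℝ × ℝ) := Set.Icc (0 : ℝ) 1 ×ˢ Set.Icc (0 : ℝ) Real.pi

/-- The essential range of a function on `[0,1] × [0,π]`. -/
def essRange (w : ℝ × ℝ → ℝ) : Set ℝ :=
  {y : ℝ | ∀ ε : ℝ, 0 < ε → 0 < MeasureTheory.volume {z : ℝ × ℝ | z ∈ rect ∧ |w z - y| < ε}}

/-- `y ↦ μ₂ {(x,θ) ∈ [0,1] × [0,π] : w(x,θ) ≤ y}`. -/
def distrFun (w : ℝ × ℝ → ℝ) (y : ℝ) : ℝ :=
  (MeasureTheory.volume {z : ℝ × ℝ | z ∈ rect ∧ w z ≤ y}).toReal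

/-- The monotone rearrangement of `w`, a function of `x ∈ (0,1)`. -/
def monoRearr (w : ℝ × ℝ → ℝ) (x : ℝ) : ℝ :=
  sInf {y : ℝ | y ∈ essRange w ∧ Real.pi * x < distrFun w y}

/-- `Ψ_φ^p`. -/
def Psi (p : ℕ) (φ : ℝ → ℝ) : ℝ → ℝ := distrFun (sqrtOmega p φ)

/-- The eigenfrequency symbol `√ξ_φ^p`. -/
def sqrtXi (p : ℕ) (φ : ℝ → ℝ) : ℝ → ℝ := monoRearr (sqrtOmega p φ)

/-- `(Ψ_φ^p)'(0)`, the right derivative (`Ψ` vanishes on the negative axis). -/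
def PsiDerivZero (p : ℕ) (φ : ℝ → ℝ) : ℝ := derivWithin (Psi p φ) (Set.Ici 0) 0

/-- `γ = π / (Ψ_φ^p)'(0)`. -/
def gammaConst (p : ℕ) (φ : ℝ → ℝ) : ℝ := Real.pi / PsiDerivZero p φ

end IGASymbol

end

namespace IGASymbol

open MeasureTheory Filter Topology

/-! The right derivative of `Ψ` at `0` equals `1`, so `γ = π`, and the bounds reduce to `2/π ≤ 1 ≤
π/2`. For fixed `x`, the slice `√e_p(θ) ≤ y φ'(x)` has length asymptotic to `y φ'(x)`, because
`√e_p(θ) ~ θ` at `0` and `√e_p` is bounded away from `0` elsewhere. Integrating in `x` gives `Ψ(y) ~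
y ∫ φ' = y`.

The facts about `e_p` come from `f_p = (2 - 2 cos θ) g_{p-1}` (`fSymb_eq`), `g_p(0) = 1` and `g_p >
0` (`gSymb_pos`). For positivity, `g_p(θ)` is, up to a power of `z = exp(iθ)`, the value at `0` of
the exponential spline of degree `2p+1`. Repeated integration by parts turns this value into the
squared `L²` norm of the exponential spline of degree `p`.

The inversion statements hold for any continuous function on the rectangle with null level sets.
Here the level sets are null because `φ'` is injective. -/

/-! ### Cardinal B-splines: support, symmetry, derivatives. -/

theorem cardBSpline_zero (x : ℝ) :
    cardBSpline 0 x = Set.indicator (Set.Ico (0 : ℝ) 1) (fun _ => (1 : ℝ)) x := by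
  rw [cardBSpline]

theorem cardBSpline_succ (n : ℕ) (x : ℝ) :
    cardBSpline (n + 1) x = x / ((n : ℝ) + 1) * cardBSpline n x
      + (((n : ℝ) + 1) + 1 - x) / ((n : ℝ) + 1) * cardBSpline n (x - 1) := by
  rw [cardBSpline]

theorem cardBSpline_of_neg (n : ℕ) {x : ℝ} (hx : x < 0) : cardBSpline n x = 0 := by
  induction n generalizing x with
  | zero => rw [cardBSpline_zero, Set.indicator_of_notMem]; simp [hx]
  | succ n ih => rw [cardBSpline_succ, ih hx, ih (by linarith)]; ring

theorem cardBSpline_of_le (n : ℕ) {x : ℝ} (hx : (n : ℝ) + 1 ≤ x) : cardBSpline n x = 0 := by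
  induction n generalizing x with
  | zero =>
    rw [cardBSpline_zero, Set.indicator_of_notMem]
    simp only [Nat.cast_zero, zero_add] at hx
    simp [hx]
  | succ n ih =>
    push_cast at hx
    rw [cardBSpline_succ, ih (by linarith), ih (by linarith)]; ring

theorem cardBSpline_succ_zero (n : ℕ) : cardBSpline (n + 1) 0 = 0 := by
  rw [cardBSpline_succ, cardBSpline_of_neg n (by norm_num : (0 : ℝ) - 1 < 0)]; ring

theorem cardBSpline_one (x : ℝ) : cardBSpline 1 x = max 0 (min x (2 - x)) := by
  refine (cardBSpline_succ 0 x).trans ?_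
  rw [cardBSpline_zero, cardBSpline_zero]
  simp only [Set.indicator_apply, Set.mem_Ico]
  rcases lt_or_ge x 0 with h | h
  · rw [if_neg (by intro h'; linarith), if_neg (by intro h'; linarith), max_eq_left]
    · simp
    · exact (min_le_left _ _).trans h.le
  rcases lt_or_ge x 1 with h1 | h1
  · rw [if_pos ⟨h, h1⟩, if_neg (by intro h'; linarith), min_eq_left (by linarith),
      max_eq_right h]
    simp
  rcases lt_or_ge x 2 with h2 | h2
  · rw [if_neg (by intro h'; linarith), if_pos ⟨by linarith, by linarith⟩,
      min_eq_right (by linarith), max_eq_right (by linarith)]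
    norm_num
  · rw [if_neg (by intro h'; linarith), if_neg (by intro h'; linarith), max_eq_left]
    · simp
    · exact (min_le_right _ _).trans (by linarith)

theorem continuous_cardBSpline_succ (n : ℕ) : Continuous (cardBSpline (n + 1)) := by
  induction n with
  | zero =>
    have : cardBSpline (0 + 1) = fun x => max 0 (min x (2 - x)) := funext cardBSpline_one
    rw [this]; fun_prop
  | succ n ih =>
    have : cardBSpline (n + 1 + 1) = fun x => x / (((n + 1 : ℕ) : ℝ) + 1) * cardBSpline (n + 1) x
        + ((((n + 1 : ℕ) : ℝ) + 1) + 1 - x) / (((n + 1 : ℕ) : ℝ) + 1)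
          * cardBSpline (n + 1) (x - 1) := funext (cardBSpline_succ _)
    rw [this]; fun_prop

theorem cardBSpline_symm (n : ℕ) (x : ℝ) :
    cardBSpline (n + 1) ((n : ℝ) + 2 - x) = cardBSpline (n + 1) x := by
  induction n generalizing x with
  | zero =>
    simp only [zero_add, cardBSpline_one, Nat.cast_zero, sub_sub_cancel]
    rw [min_comm]
  | succ n ih =>
    rw [cardBSpline_succ, cardBSpline_succ (n + 1) x]
    have h1 := ih (x - 1)
    have h2 := ih x
    rw [show (n : ℝ) + 2 - (x - 1) = ((n + 1 : ℕ) : ℝ) + 2 - x by push_cast; ring] at h1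
    rw [show (n : ℝ) + 2 - x = ((n + 1 : ℕ) : ℝ) + 2 - x - 1 by push_cast; ring] at h2
    rw [h1, h2]; push_cast; ring

/-- The half-open `[0,1)` makes `𝒩_0` constant just to the right of every point, so one-sided
calculus has no exceptional knots. -/
theorem hasDerivWithinAt_cardBSpline_zero (x : ℝ) :
    HasDerivWithinAt (cardBSpline 0) 0 (Set.Ici x) x := by
  refine (hasDerivWithinAt_const x (Set.Ici x) (cardBSpline 0 x)).congr_of_eventuallyEq ?_ rfl
  rcases lt_or_ge x 0 with h | h
  · filter_upwards [mem_nhdsWithin_of_mem_nhds (Iio_mem_nhds h)] with y hy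
    rw [cardBSpline_of_neg 0 h, cardBSpline_of_neg 0 hy]
  rcases lt_or_ge x 1 with h1 | h1
  · filter_upwards [mem_nhdsWithin_of_mem_nhds (Iio_mem_nhds h1), self_mem_nhdsWithin]
      with y hy hxy
    simp only [cardBSpline_zero]
    rw [Set.indicator_of_mem (show x ∈ Set.Ico (0 : ℝ) 1 from ⟨h, h1⟩),
      Set.indicator_of_mem (show y ∈ Set.Ico (0 : ℝ) 1 from ⟨h.trans hxy, hy⟩)]
  · filter_upwards [self_mem_nhdsWithin] with y hy
    have hy1 : 1 ≤ y := h1.trans hy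
    rw [cardBSpline_of_le 0 (x := y) (by simpa using hy1),
      cardBSpline_of_le 0 (x := x) (by simpa using h1)]

theorem hasDerivWithinAt_Ici_comp_add_const {f : ℝ → ℝ} {f' : ℝ} (x c : ℝ)
    (h : HasDerivWithinAt f f' (Set.Ici (x + c)) (x + c)) :
    HasDerivWithinAt (fun y => f (y + c)) f' (Set.Ici x) x := by
  have := h.scomp x (h := fun y => y + c) (s := Set.Ici x)
    ((hasDerivWithinAt_id x _).add_const c) (fun y hy => by simpa using hy)
  simpa [Function.comp_def] using this

theorem hasDerivWithinAt_cardBSpline_succ (n : ℕ) (x : ℝ) :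
    HasDerivWithinAt (cardBSpline (n + 1)) (cardBSpline n x - cardBSpline n (x - 1))
      (Set.Ici x) x := by
  -- The product rule applied to the defining recursion.
  have step : ∀ (n : ℕ) (x d e : ℝ), HasDerivWithinAt (cardBSpline n) d (Set.Ici x) x →
      HasDerivWithinAt (cardBSpline n) e (Set.Ici (x - 1)) (x - 1) →
      HasDerivWithinAt (cardBSpline (n + 1))
        (1 / ((n : ℝ) + 1) * cardBSpline n x + x / ((n : ℝ) + 1) * d
          + (-1 / ((n : ℝ) + 1) * cardBSpline n (x - 1)
            + (((n : ℝ) + 1) + 1 - x) / ((n : ℝ) + 1) * e)) (Set.Ici x) x := by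
    intro n x d e h1 h2
    rw [show cardBSpline (n + 1) = _ from funext (cardBSpline_succ n)]
    have h3 : HasDerivWithinAt (fun y => cardBSpline n (y - 1)) e (Set.Ici x) x := by
      simpa only [sub_eq_add_neg] using
        hasDerivWithinAt_Ici_comp_add_const x (-1) (by simpa only [sub_eq_add_neg] using h2)
    exact (((hasDerivWithinAt_id x _).div_const _).mul h1).add
      ((((hasDerivWithinAt_id x _).const_sub _).div_const _).mul h3)
  induction n generalizing x with
  | zero =>
    have := step 0 x 0 0 (hasDerivWithinAt_cardBSpline_zero _) (hasDerivWithinAt_cardBSpline_zero _)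
    convert this using 1
    simp; ring
  | succ n ih =>
    have := step (n + 1) x _ _ (ih x) (ih (x - 1))
    convert this using 1
    rw [cardBSpline_succ n x, cardBSpline_succ n (x - 1)]
    have : (n : ℝ) + 1 ≠ 0 := by positivity
    have : (n : ℝ) + 1 + 1 ≠ 0 := by positivity
    push_cast
    field_simp
    ring

/-- From degree `2` on, the right derivative is continuous, so the spline is its integral and is
differentiable on both sides. -/
theorem hasDerivAt_cardBSpline (n : ℕ) (x : ℝ) :
    HasDerivAt (cardBSpline (n + 2)) (cardBSpline (n + 1) x - cardBSpline (n + 1) (x - 1)) x := by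
  have hc : Continuous fun y => cardBSpline (n + 1) y - cardBSpline (n + 1) (y - 1) := by
    have := continuous_cardBSpline_succ n
    fun_prop
  have h : ∀ y, cardBSpline (n + 2) y = cardBSpline (n + 2) 0 +
      ∫ t in (0 : ℝ)..y, (cardBSpline (n + 1) t - cardBSpline (n + 1) (t - 1)) := by
    intro y
    rw [intervalIntegral.integral_eq_sub_of_hasDeriv_right (f := cardBSpline (n + 2))
      (continuous_cardBSpline_succ _).continuousOn
      (fun t _ => (hasDerivWithinAt_cardBSpline_succ (n + 1) t).mono Set.Ioi_subset_Ici_self)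
      (hc.intervalIntegrable _ _)]
    ring
  rw [show cardBSpline (n + 2) = _ from funext h]
  exact (intervalIntegral.integral_hasDerivAt_right (hc.intervalIntegrable _ _)
    (hc.stronglyMeasurableAtFilter _ _) hc.continuousAt).const_add _

theorem iteratedDeriv_two_cardBSpline (n : ℕ) (x : ℝ) :
    iteratedDeriv 2 (cardBSpline (n + 3)) x = cardBSpline (n + 1) x
      - 2 * cardBSpline (n + 1) (x - 1) + cardBSpline (n + 1) (x - 2) := by
  have h1 : deriv (cardBSpline (n + 3)) =
      fun x => cardBSpline (n + 2) x - cardBSpline (n + 2) (x - 1) :=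
    funext fun x => (hasDerivAt_cardBSpline (n + 1) x).deriv
  rw [iteratedDeriv_succ, iteratedDeriv_one, h1]
  have h2 := (hasDerivAt_cardBSpline n (x - 1)).comp_sub_const x 1
  rw [((hasDerivAt_cardBSpline n x).fun_sub h2).deriv, show x - 1 - 1 = x - 2 by ring]
  ring

/-! ### Exponential splines and positivity of `g_p`. -/

/-- The exponential spline `∑ₖ zᵏ 𝒩ₙ(x + k)` on `[0, 1]`. -/
noncomputable def expSpline (z : ℂ) (n : ℕ) (x : ℝ) : ℂ :=
  ∑ k ∈ Finset.range (n + 1), z ^ k * (cardBSpline n (x + k) : ℂ)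

theorem continuous_expSpline_succ (z : ℂ) (n : ℕ) : Continuous (expSpline z (n + 1)) := by
  unfold expSpline
  have := continuous_cardBSpline_succ n
  fun_prop

theorem expSpline_zero (z : ℂ) {x : ℝ} (hx : x ∈ Set.Ico (0 : ℝ) 1) : expSpline z 0 x = 1 := by
  simp [expSpline, cardBSpline_zero, hx.1, hx.2]

/-- Shift of the summation index; the two unmatched terms sit at the ends of the support. -/
theorem expSpline_quasiperiodic (z : ℂ) (n : ℕ) :
    expSpline z (n + 1) 0 = z * expSpline z (n + 1) 1 := by
  unfold expSpline
  rw [Finset.sum_range_succ', Finset.sum_range_succ _ (n + 1)]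
  rw [cardBSpline_of_le (n + 1) (x := 1 + ((n + 1 : ℕ) : ℝ)) (by linarith)]
  simp only [Nat.cast_zero, add_zero, cardBSpline_succ_zero, Complex.ofReal_zero, mul_zero,
    Finset.mul_sum]
  refine Finset.sum_congr rfl fun k _ => ?_
  rw [show (0 : ℝ) + ((k + 1 : ℕ) : ℝ) = 1 + k by push_cast; ring]
  ring

theorem sum_range_add_two_eq_expSpline (z : ℂ) (n : ℕ) {x : ℝ} (hx : x ∈ Set.Ico (0 : ℝ) 1) :
    (∑ k ∈ Finset.range (n + 2), z ^ k * (cardBSpline n (x + k) : ℂ)) = expSpline z n x := by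
  rw [Finset.sum_range_succ, cardBSpline_of_le n (by push_cast; linarith [hx.1])]
  simp [expSpline]

/-- Each `𝒩` differentiates to a backward difference, and the unit shift multiplies the sum by `z`.
-/
theorem hasDerivWithinAt_expSpline (z : ℂ) (n : ℕ) {x : ℝ} (hx : x ∈ Set.Ico (0 : ℝ) 1) :
    HasDerivWithinAt (expSpline z (n + 1)) ((1 - z) * expSpline z n x) (Set.Ici x) x := by
  have key : HasDerivWithinAt (expSpline z (n + 1)) (∑ k ∈ Finset.range (n + 2), z ^ k *
      ((cardBSpline n (x + k) - cardBSpline n (x + k - 1) : ℝ) : ℂ)) (Set.Ici x) x := by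
    unfold expSpline
    refine HasDerivWithinAt.fun_sum fun k _ => HasDerivWithinAt.const_mul _ ?_
    exact (hasDerivWithinAt_Ici_comp_add_const x k
      (hasDerivWithinAt_cardBSpline_succ n (x + k))).ofReal_comp
  convert key using 1
  simp only [Complex.ofReal_sub, mul_sub, Finset.sum_sub_distrib]
  rw [sum_range_add_two_eq_expSpline z n hx, Finset.sum_range_succ', Nat.cast_zero, add_zero,
    cardBSpline_of_neg n (by linarith [hx.2] : x - 1 < 0), sub_mul, one_mul]
  simp only [Complex.ofReal_zero, mul_zero, add_zero]
  congr 1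
  rw [expSpline, Finset.mul_sum]
  refine Finset.sum_congr rfl fun k _ => ?_
  rw [show x + ((k + 1 : ℕ) : ℝ) - 1 = x + k by push_cast; ring]
  ring

/-- Partition of unity: after reindexing, the two weights of the recursion on `𝒩_n(x + k)` add up to
`1`. It covers `z = 1`, where integration by parts degenerates. -/
theorem expSpline_one (n : ℕ) {x : ℝ} (hx : x ∈ Set.Ico (0 : ℝ) 1) : expSpline 1 n x = 1 := by
  induction n with
  | zero => exact expSpline_zero 1 hx
  | succ n ih =>
    have hn : (n : ℂ) + 1 ≠ 0 := by exact_mod_cast n.succ_ne_zero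
    have h1 := sum_range_add_two_eq_expSpline 1 n hx
    rw [ih] at h1
    have h2 : (∑ k ∈ Finset.range (n + 2), (((x + k) / (n + 1) * cardBSpline n (x + k) : ℝ) : ℂ))
        = ∑ k ∈ Finset.range (n + 1), (((x + k) / (n + 1) * cardBSpline n (x + k) : ℝ) : ℂ) := by
      rw [Finset.sum_range_succ, cardBSpline_of_le n (by push_cast; linarith [hx.1])]
      simp
    have h3 : (∑ k ∈ Finset.range (n + 2),
        ((((n : ℝ) + 1 + 1 - (x + k)) / (n + 1) * cardBSpline n (x + k - 1) : ℝ) : ℂ))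
        = ∑ k ∈ Finset.range (n + 1),
          ((((n : ℝ) + 1 - (x + k)) / (n + 1) * cardBSpline n (x + k) : ℝ) : ℂ) := by
      rw [Finset.sum_range_succ', Nat.cast_zero, add_zero,
        cardBSpline_of_neg n (by linarith [hx.2] : x - 1 < 0), mul_zero, Complex.ofReal_zero,
        add_zero]
      refine Finset.sum_congr rfl fun k _ => ?_
      rw [show x + ((k + 1 : ℕ) : ℝ) - 1 = x + k by push_cast; ring]
      push_cast; ring
    rw [expSpline]
    simp only [cardBSpline_succ, one_pow, one_mul]
    simp only [Complex.ofReal_add, Finset.sum_add_distrib] at h2 h3 ⊢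
    rw [h2, h3, ← Finset.sum_add_distrib, ← ih, expSpline]
    refine Finset.sum_congr rfl fun k _ => ?_
    push_cast; field_simp; ring

/-- The continuous extension to `[0, 1]` of the restriction of `expSpline z n` to `[0, 1)`. -/
noncomputable def expSplineExt (z : ℂ) (n : ℕ) (x : ℝ) : ℂ := if n = 0 then 1 else expSpline z n x

theorem expSplineExt_succ (z : ℂ) (n : ℕ) : expSplineExt z (n + 1) = expSpline z (n + 1) := by
  funext x; simp [expSplineExt]

/-- Only degree `0` needed changing, since `𝒩_0` drops to `0` at the end point `1`. -/
theorem continuous_expSplineExt (z : ℂ) (n : ℕ) : Continuous (expSplineExt z n) := by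
  cases n with
  | zero =>
    rw [show expSplineExt z 0 = fun _ => 1 from funext fun x => if_pos rfl]
    exact continuous_const
  | succ n => rw [expSplineExt_succ]; exact continuous_expSpline_succ z n

theorem expSplineExt_eq (z : ℂ) (n : ℕ) {x : ℝ} (hx : x ∈ Set.Ico (0 : ℝ) 1) :
    expSplineExt z n x = expSpline z n x := by
  cases n with
  | zero => simp [expSplineExt, expSpline_zero z hx]
  | succ n => rw [expSplineExt_succ]

/-- The Hermitian pairing of two exponential splines on `[0, 1]`. -/
noncomputable def expPairing (z : ℂ) (n m : ℕ) : ℂ :=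
  ∫ x in (0 : ℝ)..1, expSplineExt z n x * (starRingEnd ℂ) (expSplineExt z m x)

/-- Integration by parts. The boundary terms cancel by quasi-periodicity and `|z| = 1`; the factor
is `-(1 - z)/(1 - z̄) = z`. -/
theorem expPairing_succ {z : ℂ} (hz : ‖z‖ = 1) (hz1 : z ≠ 1) (n m : ℕ) :
    expPairing z (n + 1) m = z * expPairing z n (m + 1) := by
  have hzz : z * (starRingEnd ℂ) z = 1 := by
    rw [Complex.mul_conj, Complex.normSq_eq_norm_sq, hz]; simp
  have hc : ∀ n, Continuous fun x => (starRingEnd ℂ) (expSplineExt z n x) := fun n =>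
    Complex.continuous_conj.comp (continuous_expSplineExt z n)
  have hcc : ∀ n m, Continuous fun x =>
      expSplineExt z n x * (starRingEnd ℂ) (expSplineExt z m x) := fun n m =>
    (continuous_expSplineExt z n).mul (hc m)
  have hd : ∀ n, ∀ x ∈ Set.Ioo (0 : ℝ) 1, HasDerivWithinAt (expSplineExt z (n + 1))
      ((1 - z) * expSplineExt z n x) (Set.Ioi x) x := by
    intro n x hx
    have hx' : x ∈ Set.Ico (0 : ℝ) 1 := ⟨hx.1.le, hx.2⟩
    rw [expSplineExt_succ, expSplineExt_eq z n hx']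
    exact (hasDerivWithinAt_expSpline z n hx').mono Set.Ioi_subset_Ici_self
  have h := intervalIntegral.integral_eq_sub_of_hasDeriv_right
    (f := fun x => expSplineExt z (n + 1) x * (starRingEnd ℂ) (expSplineExt z (m + 1) x))
    (f' := fun x => (1 - z) * (expSplineExt z n x * (starRingEnd ℂ) (expSplineExt z (m + 1) x))
      + (1 - (starRingEnd ℂ) z)
        * (expSplineExt z (n + 1) x * (starRingEnd ℂ) (expSplineExt z m x)))
    (a := 0) (b := 1) (hcc _ _).continuousOn
    (by
      intro x hx
      rw [min_eq_left zero_le_one, max_eq_right zero_le_one] at hx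
      have h2 := (hd n x hx).mul (hd m x hx).star
      refine h2.congr_deriv ?_
      simp only [starRingEnd_apply, star_mul', star_sub, star_one]
      ring)
    (((hcc _ _).const_mul _).add ((hcc _ _).const_mul _) |>.intervalIntegrable _ _)
  rw [intervalIntegral.integral_add (((hcc _ _).const_mul _).intervalIntegrable _ _)
    (((hcc _ _).const_mul _).intervalIntegrable _ _), intervalIntegral.integral_const_mul,
    intervalIntegral.integral_const_mul] at h
  simp only [expSplineExt_succ, expSpline_quasiperiodic z n, expSpline_quasiperiodic z m,
    map_mul] at h
  simp only [← expSplineExt_succ] at h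
  change (1 - z) * expPairing z n (m + 1) + (1 - (starRingEnd ℂ) z) * expPairing z (n + 1) m = _
    at h
  have hne : (starRingEnd ℂ) z - 1 ≠ 0 := by
    rw [sub_ne_zero]
    intro h'
    apply hz1
    rw [← hzz, h', mul_one]
  apply mul_left_cancel₀ hne
  linear_combination (-1 : ℂ) * h + (expSplineExt z (n + 1) 1
    * (starRingEnd ℂ) (expSplineExt z (m + 1) 1) - expPairing z n (m + 1)) * hzz

theorem expPairing_add {z : ℂ} (hz : ‖z‖ = 1) (hz1 : z ≠ 1) (n j : ℕ) :
    expPairing z (n + j) 0 = z ^ j * expPairing z n j := by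
  induction j generalizing n with
  | zero => simp
  | succ j ih =>
    rw [show n + (j + 1) = n + 1 + j by ring, ih, expPairing_succ hz hz1]
    ring

/-- Pairing with the constant `1` integrates the spline, which the fundamental theorem and
quasi-periodicity evaluate. -/
theorem expPairing_zero_right {z : ℂ} (hz1 : z ≠ 1) (n : ℕ) :
    z * expPairing z n 0 = expSpline z (n + 1) 0 := by
  have h := intervalIntegral.integral_eq_sub_of_hasDeriv_right
    (f := expSpline z (n + 1)) (f' := fun x => (1 - z) * expSplineExt z n x)
    (a := 0) (b := 1) (continuous_expSpline_succ z n).continuousOn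
    (by
      intro x hx
      rw [min_eq_left zero_le_one, max_eq_right zero_le_one] at hx
      have hx' : x ∈ Set.Ico (0 : ℝ) 1 := ⟨hx.1.le, hx.2⟩
      rw [expSplineExt_eq z n hx']
      exact (hasDerivWithinAt_expSpline z n hx').mono Set.Ioi_subset_Ici_self)
    (((continuous_expSplineExt z n).const_mul _).intervalIntegrable _ _)
  rw [intervalIntegral.integral_const_mul] at h
  have h2 : expPairing z n 0 = ∫ x in (0 : ℝ)..1, expSplineExt z n x := by
    simp [expPairing, expSplineExt]
  rw [← h2] at h
  apply mul_left_cancel₀ (sub_ne_zero.2 hz1.symm)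
  linear_combination z * h - expSpline_quasiperiodic z n

/-- If the spline of degree `n + 1` vanished on `[0,1)`, so would its derivative, a nonzero multiple
of the one of degree `n`. -/
theorem exists_expSpline_ne_zero {z : ℂ} (hz1 : z ≠ 1) (n : ℕ) :
    ∃ x ∈ Set.Ico (0 : ℝ) 1, expSpline z n x ≠ 0 := by
  induction n with
  | zero => exact ⟨0, by simp, by rw [expSpline_zero z (by simp)]; exact one_ne_zero⟩
  | succ n ih =>
    obtain ⟨x, hx, hne⟩ := ih
    by_contra! h
    have h0 : HasDerivWithinAt (expSpline z (n + 1)) 0 (Set.Ici x) x := by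
      refine (hasDerivWithinAt_const x _ (0 : ℂ)).congr_of_eventuallyEq ?_ (h x hx)
      filter_upwards [mem_nhdsWithin_of_mem_nhds (Iio_mem_nhds hx.2), self_mem_nhdsWithin]
        with y hy hxy
      exact h y ⟨hx.1.trans hxy, hy⟩
    have := (uniqueDiffOn_Ici x x Set.self_mem_Ici).eq_deriv _ h0 (hasDerivWithinAt_expSpline z n hx)
    exact mul_ne_zero (sub_ne_zero.2 hz1.symm) hne this.symm

theorem exists_expPairing_self_pos {z : ℂ} (hz1 : z ≠ 1) (n : ℕ) :
    ∃ r : ℝ, 0 < r ∧ expPairing z n n = r := by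
  refine ⟨∫ x in (0 : ℝ)..1, Complex.normSq (expSplineExt z n x), ?_, ?_⟩
  · obtain ⟨x, hx, hne⟩ := exists_expSpline_ne_zero hz1 n
    refine intervalIntegral.integral_pos zero_lt_one
      (Complex.continuous_normSq.comp (continuous_expSplineExt z n)).continuousOn
      (fun _ _ => Complex.normSq_nonneg _) ⟨x, ⟨hx.1, hx.2.le⟩, ?_⟩
    rw [expSplineExt_eq z n hx]
    exact Complex.normSq_pos.2 hne
  · rw [expPairing, ← intervalIntegral.integral_ofReal]
    simp only [Complex.mul_conj]

/-- The values at integers are symmetric about `n + 1`: extract `z ^ (n + 1)` and pair `z ^ k` with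
`z ^ (-k)` into a cosine. -/
theorem expSpline_eq_gSymb (n : ℕ) (θ : ℝ) :
    expSpline (Complex.exp (θ * Complex.I)) (2 * n + 1) 0
      = Complex.exp (θ * Complex.I) ^ (n + 1) * gSymb n θ := by
  set z := Complex.exp (θ * Complex.I) with hz
  have hz0 : z ≠ 0 := Complex.exp_ne_zero _
  have hcos : ∀ k : ℕ, (2 : ℂ) * (Real.cos (k * θ) : ℂ) = z ^ k + (z ^ k)⁻¹ := by
    intro k
    rw [hz, ← Complex.exp_nat_mul, ← Complex.exp_neg, Complex.ofReal_cos, Complex.two_cos]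
    push_cast
    congr 2 <;> ring
  have hB : ∀ k : ℕ, (cardBSpline (2 * n + 1) ((n : ℝ) + 1 + k))
      = cardBSpline (2 * n + 1) ((n : ℝ) + 1 - k) := by
    intro k
    rw [← cardBSpline_symm (2 * n)]
    congr 1
    push_cast; ring
  have h1 : expSpline z (2 * n + 1) 0 = ∑ k ∈ Finset.range (n + 1 + (n + 1)),
      z ^ k * (cardBSpline (2 * n + 1) k : ℂ) := by
    rw [expSpline, show 2 * n + 1 + 1 = n + 1 + (n + 1) by ring]
    simp
  -- Split at the centre `n + 1` and reflect the lower half, so both halves are indexed by distance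
  -- to the centre.
  rw [h1, Finset.sum_range_add, ← Finset.sum_range_reflect, Finset.sum_range_succ,
    Finset.sum_range_succ']
  rw [gSymb, Finset.range_eq_Ico, Finset.sum_Ico_add' (fun k => z ^ (n + 1 + k) *
    (cardBSpline (2 * n + 1) ((n + 1 + k : ℕ) : ℝ) : ℂ)) 0 n 1, zero_add]
  have hI : Finset.Icc 1 n = Finset.Ico 1 (n + 1) := by ext; simp
  have h2 : (∑ x ∈ Finset.Ico 0 n, z ^ (n + 1 - 1 - x) *
      (cardBSpline (2 * n + 1) ((n + 1 - 1 - x : ℕ) : ℝ) : ℂ))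
      = ∑ k ∈ Finset.Ico 1 (n + 1), z ^ (n + 1 - k) *
      (cardBSpline (2 * n + 1) ((n + 1 - k : ℕ) : ℝ) : ℂ) := by
    have := Finset.sum_Ico_add' (fun k => z ^ (n + 1 - k) *
      (cardBSpline (2 * n + 1) ((n + 1 - k : ℕ) : ℝ) : ℂ)) 0 n 1
    rw [zero_add] at this
    rw [← this]
    refine Finset.sum_congr rfl fun k _ => ?_
    simp only [show n + 1 - 1 - k = n + 1 - (k + 1) by omega]
  rw [h2, hI]
  have h3 : ∀ k ∈ Finset.Ico 1 (n + 1), z ^ (n + 1 - k) *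
      (cardBSpline (2 * n + 1) ((n + 1 - k : ℕ) : ℝ) : ℂ) + z ^ (n + 1 + k) *
      (cardBSpline (2 * n + 1) ((n + 1 + k : ℕ) : ℝ) : ℂ) = z ^ (n + 1) *
      (2 * ((cardBSpline (2 * n + 1) ((n : ℝ) + 1 - k) : ℂ) * (Real.cos (k * θ) : ℂ))) := by
    intro k hk
    rw [Finset.mem_Ico] at hk
    rw [mul_left_comm 2, hcos, pow_sub₀ z hz0 (by omega), pow_add z (n + 1) k,
      Nat.cast_sub (by omega)]
    push_cast
    rw [hB k]
    ring
  have h4 := Finset.sum_congr rfl h3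
  rw [Finset.sum_add_distrib, ← Finset.mul_sum, ← Finset.mul_sum] at h4
  have h5 : cardBSpline (2 * n + 1) ((n + 1 - 1 - n : ℕ) : ℝ) = 0 := by
    rw [show n + 1 - 1 - n = 0 by omega, Nat.cast_zero, cardBSpline_succ_zero]
  rw [h5, show ((n + 1 + 0 : ℕ) : ℝ) = (n : ℝ) + 1 by push_cast; ring]
  push_cast at h4 ⊢
  linear_combination h4

theorem gSymb_zero (n : ℕ) : gSymb n 0 = 1 := by
  have h := expSpline_eq_gSymb n 0
  simp only [Complex.ofReal_zero, zero_mul, Complex.exp_zero, one_pow, one_mul] at h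
  rw [expSpline_one _ (by simp)] at h
  exact_mod_cast h.symm

/-- For `z ≠ 1`, moving `n` of the `2n` degrees across the pairing shows that `g_n(θ)` is the
squared norm of the spline of degree `n`. -/
theorem gSymb_pos (n : ℕ) {θ : ℝ} (hθ : θ ∈ Set.Icc 0 Real.pi) : 0 < gSymb n θ := by
  rcases hθ.1.eq_or_lt with h0 | h0
  · rw [← h0, gSymb_zero]; exact one_pos
  set z := Complex.exp (θ * Complex.I) with hz
  have hzn : ‖z‖ = 1 := Complex.norm_exp_ofReal_mul_I θ
  have hz1 : z ≠ 1 := by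
    intro h
    have h2 : Real.cos θ = 1 := by
      have := congrArg Complex.re h
      rwa [hz, Complex.exp_ofReal_mul_I_re, Complex.one_re] at this
    have := Real.cos_lt_cos_of_nonneg_of_le_pi le_rfl hθ.2 h0
    rw [Real.cos_zero] at this
    linarith
  obtain ⟨r, hr, hr'⟩ := exists_expPairing_self_pos hz1 n
  have h1 := expSpline_eq_gSymb n θ
  rw [← hz, ← expPairing_zero_right hz1, two_mul, expPairing_add hzn hz1, hr', ← mul_assoc,
    ← pow_succ'] at h1
  have h2 := mul_left_cancel₀ (pow_ne_zero _ (Complex.exp_ne_zero _)) h1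
  have : r = gSymb n θ := by exact_mod_cast h2
  rwa [← this]

/-! ### The factorization of `f_p`. -/

/-- Minus the second difference of an even sequence acts on its cosine series as `2 - 2 cos θ`;
truncation leaves the last two terms. -/
theorem second_difference_cos_sum (a : ℕ → ℝ) (θ : ℝ) (n : ℕ) :
    -(2 * a 1 - 2 * a 0) - 2 * ∑ k ∈ Finset.Icc 1 n,
        (a (k - 1) - 2 * a k + a (k + 1)) * Real.cos (k * θ)
      = (2 - 2 * Real.cos θ) * (a 0 + 2 * ∑ k ∈ Finset.Icc 1 n, a k * Real.cos (k * θ))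
        - 2 * a (n + 1) * Real.cos (n * θ) + 2 * a n * Real.cos ((n + 1) * θ) := by
  induction n with
  | zero => simp; ring
  | succ n ih =>
    rw [Finset.sum_Icc_succ_top (by omega), Finset.sum_Icc_succ_top (by omega)]
    have h : Real.cos (((n : ℝ) + 1 + 1) * θ)
        = 2 * Real.cos θ * Real.cos (((n : ℝ) + 1) * θ) - Real.cos (n * θ) := by
      rw [show ((n : ℝ) + 1 + 1) * θ = ((n : ℝ) + 1) * θ + θ by ring,
        show (n : ℝ) * θ = ((n : ℝ) + 1) * θ - θ by ring, Real.cos_add, Real.cos_sub]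
      ring
    push_cast
    rw [h]
    linear_combination ih

/-- `𝒩''_{2p+1}` is a second difference of `𝒩_{2p-1}`, and the truncation terms lie outside its open
support. -/
theorem fSymb_eq (n : ℕ) (θ : ℝ) :
    fSymb (n + 1) θ = (2 - 2 * Real.cos θ) * gSymb n θ := by
  set a : ℕ → ℝ := fun k => cardBSpline (2 * n + 1) ((n : ℝ) + 1 - k) with ha
  have hs : ∀ x : ℝ, cardBSpline (2 * n + 1) ((n : ℝ) + 1 + x)
      = cardBSpline (2 * n + 1) ((n : ℝ) + 1 - x) := by
    intro x
    rw [← cardBSpline_symm (2 * n)]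
    congr 1
    push_cast; ring
  have h1 : iteratedDeriv 2 (cardBSpline (2 * (n + 1) + 1)) (((n + 1 : ℕ) : ℝ) + 1)
      = 2 * a 1 - 2 * a 0 := by
    rw [show 2 * (n + 1) + 1 = 2 * n + 3 by ring, iteratedDeriv_two_cardBSpline]
    have := hs 1
    simp only [ha]
    push_cast
    rw [show (n : ℝ) + 1 + 1 - 1 = n + 1 - 0 by ring,
      show (n : ℝ) + 1 + 1 - 2 = n + 1 - 1 by ring, this]
    ring
  have h2 : ∀ k ∈ Finset.Icc 1 (n + 1),
      iteratedDeriv 2 (cardBSpline (2 * (n + 1) + 1)) (((n + 1 : ℕ) : ℝ) + 1 - k)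
        * Real.cos (k * θ) = (a (k - 1) - 2 * a k + a (k + 1)) * Real.cos (k * θ) := by
    intro k hk
    rw [Finset.mem_Icc] at hk
    rw [show 2 * (n + 1) + 1 = 2 * n + 3 by ring, iteratedDeriv_two_cardBSpline]
    simp only [ha]
    rw [Nat.cast_sub hk.1]
    push_cast
    rw [show (n : ℝ) + 1 + 1 - k - 1 = n + 1 - k by ring,
      show (n : ℝ) + 1 + 1 - k - 2 = n + 1 - (k + 1) by ring,
      show (n : ℝ) + 1 + 1 - k = n + 1 - (k - 1) by ring]
  have a1 : a (n + 1) = 0 := by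
    simp only [ha]; push_cast; rw [sub_self, cardBSpline_succ_zero]
  have a2 : a (n + 1 + 1) = 0 := by
    simp only [ha]; push_cast; exact cardBSpline_of_neg _ (by linarith)
  rw [fSymb, h1, Finset.sum_congr rfl h2, second_difference_cos_sum a θ (n + 1), a1, a2,
    Finset.sum_Icc_succ_top (by omega), a1, gSymb]
  simp [ha]

theorem continuous_gSymb (n : ℕ) : Continuous (gSymb n) := by
  unfold gSymb; fun_prop

/-! ### The rectangle. -/

theorem isCompact_rect : IsCompact rect := isCompact_Icc.prod isCompact_Icc

theorem convex_rect : Convex ℝ rect := (convex_Icc _ _).prod (convex_Icc _ _)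

theorem rect_nonempty : rect.Nonempty :=
  ⟨(0, 0), ⟨by simp, ⟨le_rfl, Real.pi_pos.le⟩⟩⟩

theorem isConnected_rect : IsConnected rect := ⟨rect_nonempty, convex_rect.isPreconnected⟩

theorem volume_rect : volume rect = ENNReal.ofReal Real.pi := by
  rw [rect, Measure.volume_eq_prod, Measure.prod_prod, Real.volume_Icc, Real.volume_Icc]
  simp

/-- Boundary points are included because a convex set with interior lies in the closure of its
interior. -/
theorem volume_rect_inter_pos {U : Set (ℝ × ℝ)} (hU : IsOpen U) {z : ℝ × ℝ} (hz : z ∈ rect)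
    (hzU : z ∈ U) : 0 < volume (rect ∩ U) := by
  have hne : (interior rect).Nonempty := by
    rw [rect, interior_prod_eq, interior_Icc, interior_Icc]
    exact (Set.nonempty_Ioo.2 zero_lt_one).prod (Set.nonempty_Ioo.2 Real.pi_pos)
  have hz' : z ∈ closure (interior rect) := by
    rw [convex_rect.closure_interior_eq_closure_of_nonempty_interior hne]
    exact subset_closure hz
  obtain ⟨u, hu, hu'⟩ := mem_closure_iff.1 hz' U hU hzU
  refine ((hU.inter isOpen_interior).measure_pos volume ⟨u, hu, hu'⟩).trans_le
    (measure_mono fun v hv => ⟨interior_subset hv.2, hv.1⟩)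

/-! ### Distribution function and rearrangement of a continuous function. -/

section Distribution

variable {w : ℝ × ℝ → ℝ}

theorem measurableSet_sublevel (hw : ContinuousOn w rect) (y : ℝ) :
    MeasurableSet {z | z ∈ rect ∧ w z ≤ y} :=
  (hw.preimage_isClosed_of_isClosed isCompact_rect.isClosed isClosed_Iic).measurableSet

theorem volume_sublevel_ne_top (y : ℝ) : volume {z | z ∈ rect ∧ w z ≤ y} ≠ ⊤ :=
  ((measure_mono fun _ h => h.1).trans_lt isCompact_rect.measure_lt_top).ne

theorem essRange_eq_image (hw : ContinuousOn w rect) : essRange w = w '' rect := by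
  ext y
  constructor
  · intro hy
    by_contra hn
    have hcl : IsClosed (w '' rect) := (isCompact_rect.image_of_continuousOn hw).isClosed
    obtain ⟨ε, hε, hb⟩ := Metric.isOpen_iff.1 hcl.isOpen_compl y hn
    have := hy ε hε
    rw [show {z : ℝ × ℝ | z ∈ rect ∧ |w z - y| < ε} = ∅ from
      Set.eq_empty_of_forall_notMem fun z hz => hb (a := w z)
        (by rw [Metric.mem_ball, Real.dist_eq]; exact hz.2) ⟨z, hz.1, rfl⟩] at this
    simp at this
  · rintro ⟨z, hz, rfl⟩ ε hε
    obtain ⟨U, hU, hzU, hsub⟩ := mem_nhdsWithin.1 (hw z hz (Metric.ball_mem_nhds _ hε))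
    refine (volume_rect_inter_pos hU hz hzU).trans_le (measure_mono fun v hv => ⟨hv.1, ?_⟩)
    have := hsub ⟨hv.2, hv.1⟩
    rwa [Set.mem_preimage, Metric.mem_ball, Real.dist_eq] at this

theorem exists_essRange_eq_Icc (hw : ContinuousOn w rect) :
    ∃ m M, m ≤ M ∧ essRange w = Set.Icc m M := by
  have hc := isConnected_rect.image w hw
  have h := eq_Icc_of_connected_compact hc (isCompact_rect.image_of_continuousOn hw)
  rw [essRange_eq_image hw]
  refine ⟨_, _, ?_, h⟩
  rw [h] at hc
  exact Set.nonempty_Icc.1 hc.1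

theorem distrFun_mono : Monotone (distrFun w) := fun _ _ h =>
  ENNReal.toReal_mono (volume_sublevel_ne_top _) (measure_mono fun _ hz => ⟨hz.1, hz.2.trans h⟩)

/-- The range is an interval, so a value strictly between `a` and `b` is attained, and near that
point `w` stays in `(a, b)` on a set of positive measure. -/
theorem distrFun_strictMonoOn (hw : ContinuousOn w rect) :
    StrictMonoOn (distrFun w) (essRange w) := by
  intro a ha b hb hab
  obtain ⟨m, M, -, hR⟩ := exists_essRange_eq_Icc hw
  have hmid : (a + b) / 2 ∈ essRange w := by
    rw [hR] at ha hb ⊢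
    constructor <;> linarith [ha.1, hb.1, ha.2, hb.2]
  rw [essRange_eq_image hw] at hmid
  obtain ⟨z, hz, hzw⟩ := hmid
  obtain ⟨U, hU, hzU, hsub⟩ := mem_nhdsWithin.1
    (hw z hz (Ioo_mem_nhds (show a < w z by linarith) (show w z < b by linarith)))
  refine (ENNReal.toReal_lt_toReal (volume_sublevel_ne_top _) (volume_sublevel_ne_top _)).2 ?_
  have hdisj : Disjoint {z | z ∈ rect ∧ w z ≤ a} (rect ∩ U) :=
    Set.disjoint_left.2 fun v hv hv' => (hsub ⟨hv'.2, hv'.1⟩).1.not_ge hv.2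
  calc volume {z | z ∈ rect ∧ w z ≤ a}
      < volume {z | z ∈ rect ∧ w z ≤ a} + volume (rect ∩ U) :=
        ENNReal.lt_add_right (volume_sublevel_ne_top _) (volume_rect_inter_pos hU hz hzU).ne'
    _ = volume ({z | z ∈ rect ∧ w z ≤ a} ∪ (rect ∩ U)) :=
        (measure_union hdisj (isCompact_rect.measurableSet.inter hU.measurableSet)).symm
    _ ≤ volume {z | z ∈ rect ∧ w z ≤ b} := measure_mono (Set.union_subset (fun v hv => ⟨hv.1, hv.2.trans hab.le⟩)
        fun v hv => ⟨hv.1, (hsub ⟨hv.2, hv.1⟩).2.le⟩)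

/-- Dominated convergence: the indicator at `z` jumps only at `y = w z`, which holds on a null set.
-/
theorem continuous_distrFun (hw : ContinuousOn w rect)
    (hnull : ∀ y, volume {z | z ∈ rect ∧ w z = y} = 0) : Continuous (distrFun w) := by
  have heq : distrFun w = fun y => ∫ z, Set.indicator {z | z ∈ rect ∧ w z ≤ y} (fun _ => (1 : ℝ)) z := by
    funext y
    rw [integral_indicator (measurableSet_sublevel hw y)]
    simp [distrFun, Measure.real]
  rw [heq, continuous_iff_continuousAt]
  intro y
  refine continuousAt_of_dominated (bound := Set.indicator rect fun _ => (1 : ℝ)) ?_ ?_ ?_ ?_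
  · exact Eventually.of_forall fun t =>
      (measurable_const.indicator (measurableSet_sublevel hw t)).aestronglyMeasurable
  · refine Eventually.of_forall fun t => Eventually.of_forall fun z => ?_
    rw [Real.norm_of_nonneg (Set.indicator_nonneg (fun _ _ => zero_le_one) _)]
    exact Set.indicator_le_indicator_of_subset (fun z hz => hz.1) (fun _ => zero_le_one) z
  · exact (integrable_indicator_iff isCompact_rect.measurableSet).2
      (integrableOn_const isCompact_rect.measure_lt_top.ne)
  · have : ∀ᵐ z, ¬(z ∈ rect ∧ w z = y) := by
      rw [ae_iff]; simpa using hnull y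
    filter_upwards [this] with z hz
    by_cases hzr : z ∈ rect
    · have hne : w z ≠ y := fun h => hz ⟨hzr, h⟩
      rcases lt_or_gt_of_ne hne with h | h
      · refine (continuousAt_const (y := (1 : ℝ))).congr ?_
        filter_upwards [Ioi_mem_nhds h] with t ht
        rw [Set.indicator_of_mem (show z ∈ {z | z ∈ rect ∧ w z ≤ t} from ⟨hzr, le_of_lt ht⟩)]
      · refine (continuousAt_const (y := (0 : ℝ))).congr ?_
        filter_upwards [Iio_mem_nhds h] with t ht
        rw [Set.indicator_of_notMem fun hm => (not_le.2 ht) hm.2]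
    · refine (continuousAt_const (y := (0 : ℝ))).congr (Eventually.of_forall fun t => ?_)
      exact (Set.indicator_of_notMem (fun hm => hzr hm.1) _).symm

theorem distrFun_bijOn (hw : ContinuousOn w rect)
    (hnull : ∀ y, volume {z | z ∈ rect ∧ w z = y} = 0) :
    Set.BijOn (distrFun w) (essRange w) (Set.Icc 0 Real.pi) := by
  refine ⟨fun y _ => ⟨ENNReal.toReal_nonneg, ?_⟩, (distrFun_strictMonoOn hw).injOn, ?_⟩
  · refine ENNReal.toReal_le_of_le_ofReal Real.pi_pos.le ?_
    rw [← volume_rect]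
    exact measure_mono fun _ h => h.1
  · obtain ⟨m, M, hmM, hR⟩ := exists_essRange_eq_Icc hw
    have hmem : ∀ z ∈ rect, w z ∈ Set.Icc m M := fun z hz => by
      rw [← hR, essRange_eq_image hw]; exact ⟨z, hz, rfl⟩
    have hm : distrFun w m = 0 := by
      rw [distrFun, show {z | z ∈ rect ∧ w z ≤ m} = {z | z ∈ rect ∧ w z = m} from
        Set.ext fun z => and_congr_right fun hz => ⟨fun h => h.antisymm (hmem z hz).1, le_of_eq⟩,
        hnull]
      rfl
    have hM : distrFun w M = Real.pi := by
      rw [distrFun, show {z | z ∈ rect ∧ w z ≤ M} = rect from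
        Set.ext fun z => and_iff_left_of_imp fun hz => (hmem z hz).2, volume_rect,
        ENNReal.toReal_ofReal Real.pi_pos.le]
    have := intermediate_value_Icc hmM (continuous_distrFun hw hnull).continuousOn
    rwa [hm, hM, ← hR] at this

/-- The infimum runs over `(y, M]` with `M` the maximum of `w`; `x < 1` makes this nonempty. -/
theorem monoRearr_eq_of_distrFun_eq (hw : ContinuousOn w rect)
    (hnull : ∀ y, volume {z | z ∈ rect ∧ w z = y} = 0) {x y : ℝ} (hx : x < 1)
    (hy : y ∈ essRange w) (hxy : distrFun w y = Real.pi * x) : monoRearr w x = y := by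
  obtain ⟨m, M, hmM, hR⟩ := exists_essRange_eq_Icc hw
  have hmono := distrFun_strictMonoOn hw
  obtain ⟨t, ht, htπ⟩ := (distrFun_bijOn hw hnull).surjOn ⟨Real.pi_pos.le, le_rfl⟩
  have hyt : y < t := by
    rw [← hmono.lt_iff_lt hy ht, hxy, htπ]
    nlinarith [Real.pi_pos]
  have hyM : y < M := by
    rw [hR] at ht; exact hyt.trans_le ht.2
  have : {s | s ∈ essRange w ∧ Real.pi * x < distrFun w s} = Set.Ioc y M := by
    ext s
    simp only [Set.mem_ofPred_eq, ← hxy]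
    constructor
    · rintro ⟨h1, h2⟩
      exact ⟨(hmono.lt_iff_lt hy h1).1 h2, by rw [hR] at h1; exact h1.2⟩
    · rintro ⟨h1, h2⟩
      have h3 : s ∈ essRange w := by
        rw [hR] at hy ⊢; exact ⟨hy.1.trans h1.le, h2⟩
      exact ⟨h3, (hmono.lt_iff_lt hy h3).2 h1⟩
  rw [monoRearr, this, csInf_Ioc hyM]

theorem monoRearr_spec (hw : ContinuousOn w rect)
    (hnull : ∀ y, volume {z | z ∈ rect ∧ w z = y} = 0) {x : ℝ} (hx : x ∈ Set.Ioo (0 : ℝ) 1) :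
    monoRearr w x ∈ essRange w ∧ distrFun w (monoRearr w x) = Real.pi * x := by
  obtain ⟨y, hy, hyx⟩ := (distrFun_bijOn hw hnull).surjOn
    (show Real.pi * x ∈ Set.Icc 0 Real.pi from
      ⟨mul_nonneg Real.pi_pos.le hx.1.le, mul_le_of_le_one_right Real.pi_pos.le hx.2.le⟩)
  rw [monoRearr_eq_of_distrFun_eq hw hnull hx.2 hy hyx]
  exact ⟨hy, hyx⟩

/-- The rearrangement `r` tends to `0⁺` and `Ψ (r x) = π x`, so substituting it in `Ψ y / y → 1`
gives the claim. -/
theorem isEquivalent_monoRearr (hw : ContinuousOn w rect)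
    (hnull : ∀ y, volume {z | z ∈ rect ∧ w z = y} = 0) (h0 : 0 ∈ essRange w)
    (hnonneg : ∀ z, 0 ≤ w z) (hder : HasDerivWithinAt (distrFun w) 1 (Set.Ici 0) 0) :
    Asymptotics.IsEquivalent (𝓝[>] (0 : ℝ)) (monoRearr w) (fun x => Real.pi * x) := by
  obtain ⟨m, M, hmM, hR⟩ := exists_essRange_eq_Icc hw
  have hbij := distrFun_bijOn hw hnull
  have hmono := distrFun_strictMonoOn hw
  have hR0 : ∀ y ∈ essRange w, 0 ≤ y := by
    intro y hy
    rw [essRange_eq_image hw] at hy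
    obtain ⟨z, -, rfl⟩ := hy
    exact hnonneg z
  have hΨ0 : distrFun w 0 = 0 := by
    obtain ⟨t, ht, ht0⟩ := hbij.surjOn ⟨le_rfl, Real.pi_pos.le⟩
    exact le_antisymm ((distrFun_mono (hR0 t ht)).trans ht0.le) ENNReal.toReal_nonneg
  have hsmall : ∀ᶠ x in 𝓝[>] (0 : ℝ), x ∈ Set.Ioo (0 : ℝ) 1 := Ioo_mem_nhdsGT zero_lt_one
  have hpos : ∀ᶠ x in 𝓝[>] (0 : ℝ), 0 < monoRearr w x := by
    filter_upwards [hsmall] with x hx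
    obtain ⟨h1, h2⟩ := monoRearr_spec hw hnull hx
    refine (hR0 _ h1).lt_of_ne fun h => ?_
    rw [← h, hΨ0] at h2
    exact (mul_pos Real.pi_pos hx.1).ne h2
  have hMpos : 0 < M := by
    obtain ⟨t, ht, htπ⟩ := hbij.surjOn ⟨Real.pi_pos.le, le_rfl⟩
    have h1 : t ≠ 0 := fun h => Real.pi_pos.ne (by rw [← htπ, h, hΨ0])
    have h2 := (hR0 t ht).lt_of_ne h1.symm
    rw [hR] at ht
    exact h2.trans_le ht.2
  have hlim : Tendsto (monoRearr w) (𝓝[>] 0) (𝓝[Set.Ici 0 \ {0}] 0) := by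
    refine tendsto_nhdsWithin_iff.2 ⟨?_, ?_⟩
    · rw [Metric.tendsto_nhds]
      intro ε hε
      -- Capping at `M` keeps `η` in the essential range, where `Ψ` is strictly monotone.
      set η := min ε M with hη
      have hηpos : 0 < η := lt_min hε hMpos
      have hηR : η ∈ essRange w := by
        rw [hR] at h0 ⊢
        exact ⟨h0.1.trans hηpos.le, min_le_right _ _⟩
      have hΨη : 0 < distrFun w η := by
        rw [← hΨ0]; exact hmono h0 hηR hηpos
      have hs : ∀ᶠ x in 𝓝[>] (0 : ℝ), x < distrFun w η / Real.pi :=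
        mem_nhdsWithin_of_mem_nhds (Iio_mem_nhds (div_pos hΨη Real.pi_pos))
      filter_upwards [hsmall, hpos, hs] with x hx hp hxs
      obtain ⟨h1, h2⟩ := monoRearr_spec hw hnull hx
      rw [Real.dist_eq, sub_zero, abs_of_pos hp]
      refine lt_of_lt_of_le ?_ (min_le_left ε M)
      rw [← hη, ← hmono.lt_iff_lt h1 hηR, h2]
      rw [lt_div_iff₀ Real.pi_pos] at hxs
      linarith
    · filter_upwards [hpos] with x hx
      exact ⟨hx.le, hx.ne'⟩
  have hslope := (hasDerivWithinAt_iff_tendsto_slope.1 hder).comp hlim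
  symm
  refine Asymptotics.isEquivalent_of_tendsto_one (hslope.congr' ?_)
  filter_upwards [hsmall] with x hx
  obtain ⟨h1, h2⟩ := monoRearr_spec hw hnull hx
  simp only [Function.comp_apply, slope_def_field, hΨ0, h2, sub_zero, Pi.div_apply]

end Distribution

/-! ### Symbols of the form `h(θ) / d(x)`. -/

section Quotient

variable {h d : ℝ → ℝ}

theorem continuousOn_quotient (hh : ContinuousOn h (Set.Icc 0 Real.pi))
    (hd : ContinuousOn d (Set.Icc 0 1)) (hd0 : ∀ x ∈ Set.Icc (0 : ℝ) 1, 0 < d x) :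
    ContinuousOn (fun z : ℝ × ℝ => h z.2 / d z.1) rect :=
  (hh.comp continuousOn_snd fun _ hz => hz.2).div (hd.comp continuousOn_fst fun _ hz => hz.1)
    fun z hz => (hd0 z.1 hz.1).ne'

/-- Fubini: for each `θ ≠ 0` injectivity of `d` leaves at most one `x` in the slice. -/
theorem volume_quotient_level_eq_zero (hh : ContinuousOn h (Set.Icc 0 Real.pi))
    (hhpos : ∀ θ ∈ Set.Ioc 0 Real.pi, 0 < h θ)
    (hd : ContinuousOn d (Set.Icc 0 1)) (hd0 : ∀ x ∈ Set.Icc (0 : ℝ) 1, 0 < d x)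
    (hinj : Set.InjOn d (Set.Icc 0 1)) (y : ℝ) :
    volume {z : ℝ × ℝ | z ∈ rect ∧ h z.2 / d z.1 = y} = 0 := by
  have hmeas : MeasurableSet {z : ℝ × ℝ | z ∈ rect ∧ h z.2 / d z.1 = y} :=
    ((continuousOn_quotient hh hd hd0).preimage_isClosed_of_isClosed isCompact_rect.isClosed
      isClosed_singleton).measurableSet
  rw [Measure.volume_eq_prod, Measure.prod_apply_symm hmeas, lintegral_eq_zero_iff
    (measurable_measure_prodMk_right hmeas)]
  have h0 : ∀ᵐ θ : ℝ, θ ≠ 0 := by simp [ae_iff]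
  filter_upwards [h0] with θ hθ
  refine Set.Subsingleton.measure_zero ?_ _
  rintro x ⟨hx, hxy⟩ x' ⟨hx', hxy'⟩
  have hp := hhpos θ ⟨lt_of_le_of_ne hx.2.1 hθ.symm, hx.2.2⟩
  have h1 := hd0 x hx.1
  have h2 := hd0 x' hx'.1
  refine hinj hx.1 hx'.1 ?_
  have h3 : h θ / d x = h θ / d x' := hxy.trans hxy'.symm
  rw [div_eq_div_iff h1.ne' h2.ne'] at h3
  exact (mul_left_cancel₀ hp.ne' h3).symm

theorem exists_sublevel_bounds (hh : ContinuousOn h (Set.Icc 0 Real.pi)) (hh0 : h 0 = 0)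
    (hhpos : ∀ θ ∈ Set.Ioc 0 Real.pi, 0 < h θ)
    (hlim : Tendsto (fun θ => h θ / θ) (𝓝[>] 0) (𝓝 1)) {ε : ℝ} (hε : 0 < ε) (hε1 : ε < 1) :
    ∃ s₀ > 0, ∀ s ∈ Set.Icc 0 s₀,
      ENNReal.ofReal ((1 - ε) * s) ≤ volume {θ | θ ∈ Set.Icc 0 Real.pi ∧ h θ ≤ s} ∧
      volume {θ | θ ∈ Set.Icc 0 Real.pi ∧ h θ ≤ s} ≤ ENNReal.ofReal ((1 + ε) * s) := by
  -- These bounds on `h θ / θ` invert to `(1 - ε) h θ ≤ θ ≤ (1 + ε) h θ`.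
  have hlo : 1 / (1 + ε) < 1 := by rw [div_lt_one (by linarith)]; linarith
  have hhi : 1 < 1 / (1 - ε) := by rw [one_lt_div (by linarith)]; linarith
  obtain ⟨δ₁, hδ₁, hsub⟩ := mem_nhdsGT_iff_exists_Ioo_subset.1 (hlim (Ioo_mem_nhds hlo hhi))
  rw [Set.mem_Ioi] at hδ₁
  set δ := min δ₁ Real.pi with hδ
  have hδpos : 0 < δ := lt_min hδ₁ Real.pi_pos
  have hb : ∀ θ ∈ Set.Ioo 0 δ, θ ≤ (1 + ε) * h θ ∧ (1 - ε) * h θ ≤ θ := by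
    intro θ hθ
    have := hsub ⟨hθ.1, hθ.2.trans_le (min_le_left _ _)⟩
    obtain ⟨h1, h2⟩ := this
    rw [div_lt_div_iff₀ (by linarith) hθ.1] at h1
    rw [div_lt_div_iff₀ hθ.1 (by linarith)] at h2
    constructor <;> nlinarith
  -- Below the minimum of `h` on `[δ, π]`, a sublevel set sees only `θ < δ`.
  obtain ⟨θ₀, hθ₀, hmin⟩ := isCompact_Icc.exists_isMinOn
    (Set.nonempty_Icc.2 (min_le_right δ₁ Real.pi))
    (hh.mono (Set.Icc_subset_Icc_left hδpos.le))
  have hc : 0 < h θ₀ := hhpos θ₀ ⟨hδpos.trans_le hθ₀.1, hθ₀.2⟩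
  refine ⟨min (h θ₀) δ / 2, half_pos (lt_min hc hδpos), fun s hs => ⟨?_, ?_⟩⟩
  · have hsδ : s < δ := by
      have := min_le_right (h θ₀) δ
      linarith [hs.2]
    rw [show (1 - ε) * s = (1 - ε) * s - 0 by ring, ← Real.volume_Ico]
    refine measure_mono fun θ hθ => ?_
    have hθδ : θ < δ := by nlinarith [hθ.2, hs.1]
    refine ⟨⟨hθ.1, (hθδ.trans_le (min_le_right _ _)).le⟩, ?_⟩
    rcases hθ.1.eq_or_lt with h0 | h0
    · rw [← h0, hh0]; exact hs.1
    · have := (hb θ ⟨h0, hθδ⟩).2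
      have h1 : (1 - ε) * h θ ≤ (1 - ε) * s := this.trans hθ.2.le
      exact le_of_mul_le_mul_left h1 (by linarith)
  · have hsc : s < h θ₀ := by
      have := min_le_left (h θ₀) δ
      linarith [hs.2]
    rw [show (1 + ε) * s = (1 + ε) * s - 0 by ring, ← Real.volume_Icc]
    refine measure_mono fun θ hθ => ⟨hθ.1.1, ?_⟩
    have hθδ : θ < δ := by
      by_contra! hcon
      have := hmin (show θ ∈ Set.Icc δ Real.pi from ⟨hcon, hθ.1.2⟩)
      exact (this.trans hθ.2).not_gt hsc
    rcases hθ.1.1.eq_or_lt with h0 | h0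
    · rw [← h0]; exact mul_nonneg (by linarith) hs.1
    · exact (hb θ ⟨h0, hθδ⟩).1.trans (mul_le_mul_of_nonneg_left hθ.2 (by linarith))

/-- The slice at `x` has length `y d(x)` up to a factor `1 ± ε`; integrating in `x` and using `∫ d =
1` leaves `y`. -/
theorem hasDerivWithinAt_distrFun_quotient (hh : ContinuousOn h (Set.Icc 0 Real.pi))
    (hh0 : h 0 = 0) (hhpos : ∀ θ ∈ Set.Ioc 0 Real.pi, 0 < h θ)
    (hlim : Tendsto (fun θ => h θ / θ) (𝓝[>] 0) (𝓝 1))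
    (hd : ContinuousOn d (Set.Icc 0 1)) (hd0 : ∀ x ∈ Set.Icc (0 : ℝ) 1, 0 < d x)
    (hinj : Set.InjOn d (Set.Icc 0 1)) (hint : ∫ x in (0 : ℝ)..1, d x = 1) :
    HasDerivWithinAt (distrFun fun z => h z.2 / d z.1) 1 (Set.Ici 0) 0 := by
  have hw := continuousOn_quotient hh hd hd0
  have hΨ0 : distrFun (fun z => h z.2 / d z.1) 0 = 0 := by
    rw [distrFun, show {z : ℝ × ℝ | z ∈ rect ∧ h z.2 / d z.1 ≤ 0}
      = {z | z ∈ rect ∧ h z.2 / d z.1 = 0} from Set.ext fun z => and_congr_right fun hz =>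
        ⟨fun hle => hle.antisymm (div_nonneg ?_ (hd0 _ hz.1).le), le_of_eq⟩,
      volume_quotient_level_eq_zero hh hhpos hd hd0 hinj]
    · rfl
    · rcases hz.2.1.eq_or_lt with h0 | h0
      · rw [← h0, hh0]
      · exact (hhpos _ ⟨h0, hz.2.2⟩).le
  obtain ⟨x₁, hx₁, hmax⟩ := isCompact_Icc.exists_isMaxOn (Set.nonempty_Icc.2 zero_le_one) hd
  have hD : 0 < d x₁ := hd0 x₁ hx₁
  have hslice : ∀ y, volume {z : ℝ × ℝ | z ∈ rect ∧ h z.2 / d z.1 ≤ y}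
      = ∫⁻ x in Set.Icc (0 : ℝ) 1, volume {θ | θ ∈ Set.Icc 0 Real.pi ∧ h θ ≤ y * d x} := by
    intro y
    rw [Measure.volume_eq_prod, Measure.prod_apply (measurableSet_sublevel hw y),
      ← lintegral_indicator measurableSet_Icc]
    refine lintegral_congr fun x => ?_
    by_cases hx : x ∈ Set.Icc (0 : ℝ) 1
    · rw [Set.indicator_of_mem hx]
      congr 1
      ext θ
      refine ⟨fun hz => ⟨hz.1.2, (div_le_iff₀ (hd0 x hx)).1 hz.2⟩,
        fun hz => ⟨⟨hx, hz.1⟩, (div_le_iff₀ (hd0 x hx)).2 hz.2⟩⟩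
    · rw [Set.indicator_of_notMem hx]
      convert measure_empty (μ := volume) using 2
      exact Set.eq_empty_of_forall_notMem fun θ hz => hx hz.1.1
  have hlin : ∀ c, 0 ≤ c →
      ∫⁻ x in Set.Icc (0 : ℝ) 1, ENNReal.ofReal (c * d x) = ENNReal.ofReal c := by
    intro c hc
    rw [← ofReal_integral_eq_lintegral_ofReal]
    · rw [integral_const_mul, integral_Icc_eq_integral_Ioc,
        ← intervalIntegral.integral_of_le zero_le_one, hint, mul_one]
    · exact (hd.integrableOn_compact isCompact_Icc).const_mul c
    · exact (ae_restrict_mem measurableSet_Icc).mono fun x hx => mul_nonneg hc (hd0 x hx).le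
  rw [hasDerivWithinAt_iff_tendsto_slope, show Set.Ici (0 : ℝ) \ {0} = Set.Ioi 0 by simp,
    Metric.tendsto_nhds]
  intro ε' hε'
  set ε := min (ε' / 2) (1 / 2) with hεdef
  have hε : 0 < ε := lt_min (half_pos hε') (by norm_num)
  have hε1 : ε < 1 := (min_le_right _ _).trans_lt (by norm_num)
  have hεε : ε < ε' := (min_le_left _ _).trans_lt (half_lt_self hε')
  obtain ⟨s₀, hs₀, hb⟩ := exists_sublevel_bounds hh hh0 hhpos hlim hε hε1
  -- With `y` below `s₀ / max d`, the slice bounds hold for all `x` at once.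
  filter_upwards [Ioo_mem_nhdsGT (div_pos hs₀ hD)] with y hy
  have hmem : ∀ x ∈ Set.Icc (0 : ℝ) 1, y * d x ∈ Set.Icc 0 s₀ := fun x hx =>
    ⟨mul_nonneg hy.1.le (hd0 x hx).le,
      (mul_le_mul_of_nonneg_left (hmax hx) hy.1.le).trans ((lt_div_iff₀ hD).1 hy.2).le⟩
  have hlow : (1 - ε) * y ≤ distrFun (fun z => h z.2 / d z.1) y := by
    refine (ENNReal.ofReal_le_iff_le_toReal (volume_sublevel_ne_top _)).1 ?_
    rw [hslice, ← hlin _ (mul_nonneg (by linarith) hy.1.le)]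
    refine setLIntegral_mono' measurableSet_Icc fun x hx => ?_
    rw [mul_assoc]
    exact (hb _ (hmem x hx)).1
  have hupp : distrFun (fun z => h z.2 / d z.1) y ≤ (1 + ε) * y := by
    refine ENNReal.toReal_le_of_le_ofReal (mul_nonneg (by linarith) hy.1.le) ?_
    rw [hslice, ← hlin _ (mul_nonneg (by linarith) hy.1.le)]
    refine setLIntegral_mono' measurableSet_Icc fun x hx => ?_
    rw [mul_assoc]
    exact (hb _ (hmem x hx)).2
  rw [slope_def_field, hΨ0, sub_zero, sub_zero, Real.dist_eq, abs_lt, lt_sub_iff_add_lt,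
    sub_lt_iff_lt_add, lt_div_iff₀ hy.1, div_lt_iff₀ hy.1]
  constructor <;> nlinarith [hy.1]

end Quotient

/-! ### The derivative of a reparametrization. -/

theorem IsReparam.continuousOn_deriv {φ : ℝ → ℝ} (hφ : IsReparam φ) :
    ContinuousOn (derivWithin φ (Set.Icc 0 1)) (Set.Icc 0 1) :=
  hφ.contDiffOn.continuousOn_derivWithin (uniqueDiffOn_Icc zero_lt_one) (by norm_num)

theorem IsReparam.injOn_deriv {φ : ℝ → ℝ} (hφ : IsReparam φ) :
    Set.InjOn (derivWithin φ (Set.Icc 0 1)) (Set.Icc 0 1) := by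
  have h : ∀ x ∈ interior (Set.Icc (0 : ℝ) 1), deriv (derivWithin φ (Set.Icc 0 1)) x
      = iteratedDerivWithin 2 φ (Set.Icc 0 1) x := by
    intro x hx
    rw [iteratedDerivWithin_succ, derivWithin_of_mem_nhds (mem_interior_iff_mem_nhds.1 hx)]
    refine EventuallyEq.deriv_eq ?_
    filter_upwards [mem_interior_iff_mem_nhds.1 hx] with y hy
    rw [iteratedDerivWithin_one]
  rcases hφ.second_deriv_sign with hs | hs
  · exact (strictMonoOn_of_deriv_pos (convex_Icc _ _) hφ.continuousOn_deriv fun x hx => by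
      rw [h x hx]; exact hs x (interior_subset hx)).injOn
  · exact (strictAntiOn_of_deriv_neg (convex_Icc _ _) hφ.continuousOn_deriv fun x hx => by
      rw [h x hx]; exact hs x (interior_subset hx)).injOn

theorem IsReparam.integral_deriv {φ : ℝ → ℝ} (hφ : IsReparam φ) :
    ∫ x in (0 : ℝ)..1, derivWithin φ (Set.Icc 0 1) x = 1 := by
  rw [intervalIntegral.integral_derivWithin_Icc_of_contDiffOn_Icc
    (hφ.contDiffOn.of_le (by norm_num)) zero_le_one, hφ.map_one, hφ.map_zero, sub_zero]

/-! ### The symbol `√e_p`. -/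

theorem eSymb_eq (n : ℕ) (θ : ℝ) :
    eSymb (n + 1) θ = (2 * Real.sin (θ / 2)) ^ 2 * (gSymb n θ / gSymb (n + 1) θ) := by
  rw [eSymb, fSymb_eq, mul_pow, Real.sin_sq_eq_half_sub, mul_div_cancel₀ θ two_ne_zero]
  ring

theorem sqrt_eSymb_eq (n : ℕ) {θ : ℝ} (hθ : θ ∈ Set.Icc 0 Real.pi) :
    √(eSymb (n + 1) θ) = 2 * Real.sin (θ / 2) * √(gSymb n θ / gSymb (n + 1) θ) := by
  have : 0 ≤ Real.sin (θ / 2) :=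
    Real.sin_nonneg_of_nonneg_of_le_pi (by linarith [hθ.1]) (by linarith [hθ.1, hθ.2])
  rw [eSymb_eq, Real.sqrt_mul (sq_nonneg _), Real.sqrt_sq (by positivity)]

theorem continuousOn_sqrt_gSymb_div (n : ℕ) :
    ContinuousOn (fun θ => √(gSymb n θ / gSymb (n + 1) θ)) (Set.Icc 0 Real.pi) :=
  ((continuous_gSymb n).continuousOn.div (continuous_gSymb (n + 1)).continuousOn
    fun _ hθ => (gSymb_pos (n + 1) hθ).ne').sqrt

theorem continuousOn_sqrt_eSymb (n : ℕ) :
    ContinuousOn (fun θ => √(eSymb (n + 1) θ)) (Set.Icc 0 Real.pi) := by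
  refine ContinuousOn.congr (ContinuousOn.mul ?_ (continuousOn_sqrt_gSymb_div n))
    fun θ hθ => sqrt_eSymb_eq n hθ
  fun_prop

theorem sqrt_eSymb_zero (n : ℕ) : √(eSymb (n + 1) 0) = 0 := by
  simp [eSymb_eq]

theorem sqrt_eSymb_pos (n : ℕ) {θ : ℝ} (hθ : θ ∈ Set.Ioc 0 Real.pi) :
    0 < √(eSymb (n + 1) θ) := by
  have hθ' : θ ∈ Set.Icc 0 Real.pi := ⟨hθ.1.le, hθ.2⟩
  have h1 : 0 < Real.sin (θ / 2) :=
    Real.sin_pos_of_pos_of_lt_pi (by linarith [hθ.1]) (by linarith [hθ.2, Real.pi_pos])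
  have h2 := div_pos (gSymb_pos n hθ') (gSymb_pos (n + 1) hθ')
  rw [sqrt_eSymb_eq n hθ']
  positivity

/-- `2 sin(θ/2)` has slope `1` at `0`, and the quotient of the `g`'s tends to `1` since both equal
`1` there. -/
theorem tendsto_sqrt_eSymb_div (n : ℕ) :
    Tendsto (fun θ => √(eSymb (n + 1) θ) / θ) (𝓝[>] 0) (𝓝 1) := by
  have h1 : Tendsto (fun θ => √(gSymb n θ / gSymb (n + 1) θ)) (𝓝[>] 0) (𝓝 1) := by
    have := (continuousOn_sqrt_gSymb_div n) 0 ⟨le_rfl, Real.pi_pos.le⟩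
    rw [ContinuousWithinAt, gSymb_zero, gSymb_zero, div_one, Real.sqrt_one,
      nhdsWithin_Icc_eq_nhdsGE Real.pi_pos] at this
    exact this.mono_left (nhdsWithin_mono _ Set.Ioi_subset_Ici_self)
  have h2 : Tendsto (fun θ : ℝ => 2 * Real.sin (θ / 2) / θ) (𝓝[>] 0) (𝓝 1) := by
    have hd : HasDerivAt (fun θ : ℝ => 2 * Real.sin (θ / 2)) 1 0 := by
      have := (((hasDerivAt_id (0 : ℝ)).div_const 2).sin).const_mul 2
      simpa using this
    have := (hasDerivAt_iff_tendsto_slope.1 hd).mono_left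
      (nhdsWithin_mono (0 : ℝ) fun θ (hθ : 0 < θ) => hθ.ne')
    refine this.congr fun θ => ?_
    simp [slope_def_field]
  have h3 := h2.mul h1
  rw [mul_one] at h3
  refine h3.congr' ?_
  filter_upwards [Ioc_mem_nhdsGT Real.pi_pos] with θ hθ
  rw [sqrt_eSymb_eq n ⟨hθ.1.le, hθ.2⟩]
  ring

/-- `√ω` with the square root taken out of the quotient, on the whole plane. -/
theorem sqrtOmega_eq_div_abs (p : ℕ) (φ : ℝ → ℝ) :
    sqrtOmega p φ = fun z => √(eSymb p z.2) / |derivWithin φ (Set.Icc 0 1) z.1| := by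
  funext z
  rw [sqrtOmega, Real.sqrt_div' _ (sq_nonneg _), Real.sqrt_sq_eq_abs]

end IGASymbol

/-! ### The main theorem. -/

theorem theorem3p1 (p : ℕ) (hp : 1 ≤ p) (φ : ℝ → ℝ) (hφ : IGASymbol.IsReparam φ)
    (hconv : ConvexOn ℝ (Set.Icc 0 1) φ) :
    -- `√ξ(x)` is the inverse of `Ψ`, taken on the essential range of `√ω`, at `π x`
    Set.BijOn (IGASymbol.Psi p φ) (IGASymbol.essRange (IGASymbol.sqrtOmega p φ))
      (Set.Icc 0 Real.pi) ∧
    (∀ x ∈ Set.Ioo (0 : ℝ) 1,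
      IGASymbol.sqrtXi p φ x ∈ IGASymbol.essRange (IGASymbol.sqrtOmega p φ) ∧
      IGASymbol.Psi p φ (IGASymbol.sqrtXi p φ x) = Real.pi * x) ∧
    -- the right derivative of `Ψ` at `0` exists and is positive, and so is `γ`
    DifferentiableWithinAt ℝ (IGASymbol.Psi p φ) (Set.Ici 0) 0 ∧
    0 < IGASymbol.PsiDerivZero p φ ∧
    0 < IGASymbol.gammaConst p φ ∧
    -- `√ξ(x) ~ γ x` as `x → 0⁺`
    Asymptotics.IsEquivalent (nhdsWithin (0 : ℝ) (Set.Ioi 0))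
      (IGASymbol.sqrtXi p φ) (fun x => IGASymbol.gammaConst p φ * x) ∧
    -- the bounds on the derivative for `p ≥ 2`
    (2 ≤ p →
      (2 / Real.pi) ^ (((p : ℝ) + 1) / 2) ≤ IGASymbol.PsiDerivZero p φ ∧
      IGASymbol.PsiDerivZero p φ ≤ (Real.pi / 2) ^ (((p : ℝ) - 1) / 2)) := by
  open IGASymbol in
  obtain ⟨n, rfl⟩ : ∃ n, p = n + 1 := ⟨p - 1, by omega⟩
  set h : ℝ → ℝ := fun θ => √(eSymb (n + 1) θ)
  -- The absolute value makes `√ω = h / d` an identity on the whole plane, not just on the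
  -- rectangle.
  set d : ℝ → ℝ := fun x => |derivWithin φ (Set.Icc 0 1) x|
  have hdeq : ∀ x ∈ Set.Icc (0 : ℝ) 1, d x = derivWithin φ (Set.Icc 0 1) x := fun x hx =>
    abs_of_pos (hφ.deriv_pos x hx)
  have hd : ContinuousOn d (Set.Icc 0 1) := hφ.continuousOn_deriv.congr hdeq
  have hd0 : ∀ x ∈ Set.Icc (0 : ℝ) 1, 0 < d x := fun x hx => by
    rw [hdeq x hx]; exact hφ.deriv_pos x hx
  have hinj : Set.InjOn d (Set.Icc 0 1) :=
    (Set.EqOn.injOn_iff hdeq).2 hφ.injOn_deriv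
  have hint : ∫ x in (0 : ℝ)..1, d x = 1 := by
    refine (intervalIntegral.integral_congr fun x hx => hdeq x ?_).trans hφ.integral_deriv
    rwa [Set.uIcc_of_le zero_le_one] at hx
  have hh : ContinuousOn h (Set.Icc 0 Real.pi) := continuousOn_sqrt_eSymb n
  have hhpos : ∀ θ ∈ Set.Ioc 0 Real.pi, 0 < h θ := fun θ hθ => sqrt_eSymb_pos n hθ
  have hω : sqrtOmega (n + 1) φ = fun z => h z.2 / d z.1 := sqrtOmega_eq_div_abs _ φ
  have hw : ContinuousOn (sqrtOmega (n + 1) φ) rect := by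
    rw [hω]; exact continuousOn_quotient hh hd hd0
  have hnull : ∀ y, MeasureTheory.volume {z | z ∈ rect ∧ sqrtOmega (n + 1) φ z = y} = 0 := by
    rw [hω]; exact volume_quotient_level_eq_zero hh hhpos hd hd0 hinj
  have hder : HasDerivWithinAt (Psi (n + 1) φ) 1 (Set.Ici 0) 0 := by
    rw [Psi, hω]
    exact hasDerivWithinAt_distrFun_quotient hh (sqrt_eSymb_zero n) hhpos
      (tendsto_sqrt_eSymb_div n) hd hd0 hinj hint
  have h0 : (0 : ℝ) ∈ essRange (sqrtOmega (n + 1) φ) := by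
    rw [essRange_eq_image hw]
    refine ⟨(0, 0), ⟨by simp, ⟨le_rfl, Real.pi_pos.le⟩⟩, ?_⟩
    rw [hω]
    simp [h, sqrt_eSymb_zero n]
  have hPsi : PsiDerivZero (n + 1) φ = 1 := hder.derivWithin (uniqueDiffOn_Ici 0 0 Set.self_mem_Ici)
  have hγ : gammaConst (n + 1) φ = Real.pi := by rw [gammaConst, hPsi, div_one]
  refine ⟨distrFun_bijOn hw hnull, fun x hx => monoRearr_spec hw hnull hx,
    hder.differentiableWithinAt, by rw [hPsi]; exact one_pos, by rw [hγ]; exact Real.pi_pos, ?_,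
    fun _ => ?_⟩
  · rw [hγ]
    exact isEquivalent_monoRearr hw hnull h0 (fun z => Real.sqrt_nonneg _) hder
  · rw [hPsi]
    have hπ := Real.two_le_pi
    have hn : (0 : ℝ) ≤ n := n.cast_nonneg
    push_cast
    exact ⟨Real.rpow_le_one (by positivity) ((div_le_one Real.pi_pos).2 hπ) (by positivity),
      Real.one_le_rpow ((one_le_div two_pos).2 hπ) (by linarith)⟩
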